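/- An operator system is a norm-closed subspace $E \subseteq B(H)$, for a complex Hilbert space $H$, with $x^* \in E$ whenever $x \in E$; it is unital if $1_H \in E$. For $n\ge 1$, $M_n(E) \subseteq M_n(B(H)) = B(H^n)$ carries the operator norm and the order of $B(H^n)$. A linear map $\varphi : E \to F$ between operator systems is cpcc if for every $n$ the entrywise map $M_n(E) \to M_n(F)$ sends positive elements to positive elements and is contractive. $E$ has the completely positive approximation property (CPAP) if there is a net of cpcc maps $\psi_i : E \to M_{n_i}(\mathbb{C})$ and $\varphi_i : M_{n_i}(\mathbb{C}) \to E$, $n_i \geq 1$, with $\lim_i \|\varphi_i(\psi_i(x)) - x\| = 0$ for every $x \in E$. Say that $E$ is a C*-algebra if it is isomorphic as an operator system to a C*-algebra, that is, if there are a Hilbert space $L$, a norm-closed $*$-subalgebra $A \subseteq B(L)$ and a linear bijection $E \to A$ which is cpcc with cpcc inverse. **Proposition.** Let $E \subseteq B(H)$ be a unital operator system with the CPAP. Then the spatial tensor product $$E \otimes c_0(\mathbb{N}) := \overline{\operatorname{span}}\{x \otimes f : x \in E,\ f \in c_0(\mathbb{N})\} \subseteq B(H \otimes \ell^2(\mathbb{N})),$$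 where $c_0(\mathbb{N})$ acts on $\ell^2(\mathbb{N})$ by multiplication, has the CPAP. Furthermore, if $E \otimes c_0(\mathbb{N})$ is a C*-algebra, then $E$ is a C*-algebra. -/

import Mathlib

open Filter Topology
open scoped ZeroAtInfty ENNReal

universe u v

namespace OpSys

noncomputable section

/-- A (concrete, possibly non-unital) operator system: a norm-closed subspace of `B(H)` that is
closed under the adjoint. -/
structure OperatorSystem (H : Type u) [NormedAddCommGroup H] [InnerProductSpace ℂ H]
    [CompleteSpace H] extends Submodule ℂ (H →L[ℂ] H) where
  isClosed' : IsClosed (carrier : Set (H →L[ℂ] H))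
  star_mem' : ∀ x ∈ carrier, star x ∈ carrier

/-- An operator system is unital when it contains the identity operator. -/
def OperatorSystem.IsUnital {H : Type u} [NormedAddCommGroup H] [InnerProductSpace ℂ H]
    [CompleteSpace H] (E : OperatorSystem H) : Prop :=
  (1 : H →L[ℂ] H) ∈ E.toSubmodule

/-- All of `B(H)`, as an operator system. -/
def OperatorSystem.full (H : Type u) [NormedAddCommGroup H] [InnerProductSpace ℂ H]
    [CompleteSpace H] : OperatorSystem H where
  toSubmodule := ⊤
  isClosed' := isClosed_univ
  star_mem' := fun _ _ => trivial

/-- The `n × n` complex matrices `M_n = B(ℂⁿ)`, as an operator system. -/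
abbrev matrixSystem (n : ℕ) : OperatorSystem (EuclideanSpace ℂ (Fin n)) :=
  OperatorSystem.full (EuclideanSpace ℂ (Fin n))

/-! ### Matrix norms, matrix order, and the maps that respect them -/

/-- The operator on the `n`-fold Hilbert space direct sum `Hⁿ` given by an `n × n` matrix of
operators on `H`: it sends `ξ` to the vector with `i`-th entry `∑ j, X i j (ξ j)`. -/
def blockOp {H : Type u} [NormedAddCommGroup H] [InnerProductSpace ℂ H] {n : ℕ}
    (X : Matrix (Fin n) (Fin n) (H →L[ℂ] H)) :
    PiLp 2 (fun _ : Fin n => H) →L[ℂ] PiLp 2 (fun _ : Fin n => H) :=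
  ((PiLp.continuousLinearEquiv 2 ℂ (fun _ : Fin n => H)).symm :
      (Fin n → H) →L[ℂ] PiLp 2 (fun _ : Fin n => H)) ∘L
    ContinuousLinearMap.pi fun i => ∑ j, X i j ∘L PiLp.proj 2 (fun _ : Fin n => H) j

theorem blockOp_apply {H : Type u} [NormedAddCommGroup H] [InnerProductSpace ℂ H] {n : ℕ}
    (X : Matrix (Fin n) (Fin n) (H →L[ℂ] H)) (ξ : PiLp 2 (fun _ : Fin n => H)) (i : Fin n) :
    blockOp X ξ i = ∑ j, X i j (ξ j) := by
  simp [blockOp]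

section Maps

variable {H : Type u} [NormedAddCommGroup H] [InnerProductSpace ℂ H] [CompleteSpace H]
variable {K : Type v} [NormedAddCommGroup K] [InnerProductSpace ℂ K] [CompleteSpace K]

/-- A matrix over `E`, regarded as an operator on `Hⁿ`. -/
def OperatorSystem.amp (E : OperatorSystem H) {n : ℕ}
    (X : Matrix (Fin n) (Fin n) E.toSubmodule) :
    PiLp 2 (fun _ : Fin n => H) →L[ℂ] PiLp 2 (fun _ : Fin n => H) :=
  blockOp (X.map (fun x => (x : H →L[ℂ] H)))

/-- `φ` is completely positive: each amplification `M_n(E) → M_n(F)` maps positive elements to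
positive elements. -/
def IsCompletelyPositive {E : OperatorSystem H} {F : OperatorSystem K}
    (φ : E.toSubmodule →ₗ[ℂ] F.toSubmodule) : Prop :=
  ∀ (n : ℕ) (X : Matrix (Fin n) (Fin n) E.toSubmodule),
    (E.amp X).IsPositive → (F.amp (X.map φ)).IsPositive

/-- `φ` is completely contractive: each amplification `M_n(E) → M_n(F)` is contractive. -/
def IsCompletelyContractive {E : OperatorSystem H} {F : OperatorSystem K}
    (φ : E.toSubmodule →ₗ[ℂ] F.toSubmodule) : Prop :=
  ∀ (n : ℕ) (X : Matrix (Fin n) (Fin n) E.toSubmodule), ‖F.amp (X.map φ)‖ ≤ ‖E.amp X‖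

/-- Completely positive and completely contractive (cpcc) maps. -/
def IsCPCC {E : OperatorSystem H} {F : OperatorSystem K}
    (φ : E.toSubmodule →ₗ[ℂ] F.toSubmodule) : Prop :=
  IsCompletelyPositive φ ∧ IsCompletelyContractive φ

/-- Isomorphism of operator systems: a linear bijection that is cpcc with cpcc inverse, that is,
a completely isometric complete order isomorphism. -/
def Isomorphic (E : OperatorSystem H) (F : OperatorSystem K) : Prop :=
  ∃ e : E.toSubmodule ≃ₗ[ℂ] F.toSubmodule,
    IsCPCC (E := E) (F := F) e.toLinearMap ∧ IsCPCC (E := F) (F := E) e.symm.toLinearMap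

/-- The completely positive approximation property: there is a net of cpcc maps
`ψ i : E → M_{n i}` and `φ i : M_{n i} → E`, with `n i ≥ 1`, such that `φ i ∘ ψ i` converges to
the identity of `E` in the point-norm topology. -/
def HasCPAP (E : OperatorSystem H) : Prop :=
  ∃ (ι : Type u) (_ : Preorder ι) (_ : IsDirectedOrder ι) (_ : Nonempty ι) (n : ι → ℕ)
    (ψ : ∀ i, E.toSubmodule →ₗ[ℂ] (matrixSystem (n i)).toSubmodule)
    (φ : ∀ i, (matrixSystem (n i)).toSubmodule →ₗ[ℂ] E.toSubmodule),
    (∀ i, 1 ≤ n i) ∧ (∀ i, IsCPCC (ψ i)) ∧ (∀ i, IsCPCC (φ i)) ∧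
      ∀ x : E.toSubmodule, Tendsto (fun i => φ i (ψ i x)) atTop (𝓝 x)

/-- An operator system is a C*-algebra when, as an operator system, it is isomorphic to a
C*-algebra, that is, to a norm-closed `*`-subalgebra of the bounded operators on some Hilbert
space. -/
def IsCStarAlgebra (E : OperatorSystem H) : Prop :=
  ∃ (L : Type u) (_ : NormedAddCommGroup L) (_ : InnerProductSpace ℂ L) (_ : CompleteSpace L)
    (A : OperatorSystem L),
    (∀ x ∈ A.toSubmodule, ∀ y ∈ A.toSubmodule, x * y ∈ A.toSubmodule) ∧ Isomorphic E A

end Maps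

/-! ### The spatial tensor product with `c₀(ℕ)`

The Hilbert space tensor product `H ⊗ ℓ²(ℕ)` is `ℓ²(ℕ; H)`, with `ξ ⊗ η = (η(n) ξ)_n`; the lemmas
on `tmul` below say that this is a tensor product of Hilbert spaces. The space `c₀(ℕ)` acts on
`ℓ²(ℕ)` by multiplication. -/

section Tensor

variable {H : Type u} [NormedAddCommGroup H] [InnerProductSpace ℂ H]

/-- The Hilbert space `H ⊗ ℓ²(ℕ) = ℓ²(ℕ; H)`. -/
abbrev TensorL2 (H : Type u) [NormedAddCommGroup H] : Type u := lp (fun _ : ℕ => H) 2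

/-- The elementary tensor `ξ ⊗ η` in `H ⊗ ℓ²(ℕ)`. -/
def tmul (ξ : H) (η : lp (fun _ : ℕ => ℂ) 2) : TensorL2 H :=
  ⟨fun n => η n • ξ,
    ((lp.memℓp η).norm.const_mul ‖ξ‖).mono' fun n => by simp [norm_smul, mul_comm]⟩

@[simp]
theorem tmul_apply (ξ : H) (η : lp (fun _ : ℕ => ℂ) 2) (n : ℕ) : tmul ξ η n = η n • ξ := rfl

theorem inner_tmul (ξ ξ' : H) (η η' : lp (fun _ : ℕ => ℂ) 2) :
    inner ℂ (tmul ξ η) (tmul ξ' η') = inner ℂ ξ ξ' * inner ℂ η η' := by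
  rw [lp.inner_eq_tsum, lp.inner_eq_tsum, ← tsum_mul_left]
  refine tsum_congr fun n => ?_
  simp only [tmul_apply, inner_smul_left, inner_smul_right, RCLike.inner_apply]
  ring

theorem dense_span_tmul :
    (Submodule.span ℂ {ζ : TensorL2 H | ∃ ξ η, ζ = tmul ξ η}).topologicalClosure = ⊤ := by
  rw [eq_top_iff]
  intro ζ _
  refine mem_closure_of_tendsto (lp.hasSum_single (by norm_num) ζ) (Eventually.of_forall ?_)
  intro s
  refine Submodule.sum_mem _ fun n _ => Submodule.subset_span ⟨ζ n, lp.single 2 n 1, ?_⟩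
  ext m
  by_cases h : m = n
  · subst h
    simp
  · simp [lp.single_apply, Pi.single_eq_of_ne h]

theorem memℓp_tensorOp (x : H →L[ℂ] H) (f : C₀(ℕ, ℂ)) (ζ : TensorL2 H) :
    Memℓp (fun n => f n • x (ζ n)) 2 :=
  ((lp.memℓp ζ).norm.const_mul (‖f‖ * ‖x‖)).mono' fun n => by
    refine le_trans ?_ (le_abs_self (‖f‖ * ‖x‖ * ‖ζ n‖))
    rw [norm_smul, mul_assoc]
    gcongr
    · exact f.toBCF.norm_coe_le_norm n
    · exact x.le_opNorm _

/-- The operator `x ⊗ f` on `H ⊗ ℓ²(ℕ)`, where `f ∈ c₀(ℕ)` acts on `ℓ²(ℕ)` by multiplication. -/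
def tensorOp (x : H →L[ℂ] H) (f : C₀(ℕ, ℂ)) : TensorL2 H →L[ℂ] TensorL2 H :=
  LinearMap.mkContinuous
    { toFun := fun ζ => ⟨fun n => f n • x (ζ n), memℓp_tensorOp x f ζ⟩
      map_add' := fun ζ ζ' => by
        ext n
        change f n • x (ζ n + ζ' n) = f n • x (ζ n) + f n • x (ζ' n)
        rw [map_add, smul_add]
      map_smul' := fun c ζ => by
        ext n
        simp [smul_smul, mul_comm] }
    (‖f‖ * ‖x‖) fun ζ => by
      have h : ‖(⟨fun n => f n • x (ζ n), memℓp_tensorOp x f ζ⟩ : TensorL2 H)‖ ≤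
          ‖((‖f‖ * ‖x‖ : ℝ) : ℂ) • ζ‖ := by
        refine lp.norm_mono (by norm_num) fun n => ?_
        have h0 : 0 ≤ ‖f‖ * ‖x‖ := by positivity
        change ‖f n • x (ζ n)‖ ≤ ‖((‖f‖ * ‖x‖ : ℝ) : ℂ) • ζ n‖
        rw [norm_smul, norm_smul, Complex.norm_real, Real.norm_of_nonneg h0, mul_assoc]
        gcongr
        · exact f.toBCF.norm_coe_le_norm n
        · exact x.le_opNorm _
      refine h.trans (le_of_eq ?_)
      rw [norm_smul, Complex.norm_real, Real.norm_of_nonneg (by positivity)]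

@[simp]
theorem tensorOp_apply (x : H →L[ℂ] H) (f : C₀(ℕ, ℂ)) (ζ : TensorL2 H) (n : ℕ) :
    tensorOp x f ζ n = f n • x (ζ n) := rfl

/-- `(x ⊗ f)(ξ ⊗ η) = xξ ⊗ fη`. -/
theorem tensorOp_tmul (x : H →L[ℂ] H) (f : C₀(ℕ, ℂ)) (ξ : H) (η fη : lp (fun _ : ℕ => ℂ) 2)
    (h : ∀ n, fη n = f n * η n) : tensorOp x f (tmul ξ η) = tmul (x ξ) fη := by
  ext n
  simp [h, smul_smul]

variable [CompleteSpace H]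

theorem star_tensorOp (x : H →L[ℂ] H) (f : C₀(ℕ, ℂ)) :
    star (tensorOp x f) = tensorOp (star x) (star f) := by
  rw [ContinuousLinearMap.star_eq_adjoint, eq_comm, ContinuousLinearMap.eq_adjoint_iff]
  intro ζ ζ'
  rw [lp.inner_eq_tsum, lp.inner_eq_tsum]
  refine tsum_congr fun n => ?_
  simp [inner_smul_left, inner_smul_right, ContinuousLinearMap.star_eq_adjoint,
    ContinuousLinearMap.adjoint_inner_left]

/-- The spatial tensor product `E ⊗ c₀(ℕ)`: the norm closure in `B(H ⊗ ℓ²(ℕ))` of the linear span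
of the operators `x ⊗ f` with `x ∈ E` and `f ∈ c₀(ℕ)`. -/
def tensorC0 (E : OperatorSystem H) : OperatorSystem (TensorL2 H) where
  toSubmodule :=
    (Submodule.span ℂ {T : TensorL2 H →L[ℂ] TensorL2 H |
      ∃ x ∈ E.toSubmodule, ∃ f : C₀(ℕ, ℂ), T = tensorOp x f}).topologicalClosure
  isClosed' := Submodule.isClosed_topologicalClosure _
  star_mem' := by
    intro T hT
    refine map_mem_closure continuous_star hT ?_
    intro S hS
    refine Submodule.span_induction (p := fun S _ => star S ∈ Submodule.span ℂ
      {T : TensorL2 H →L[ℂ] TensorL2 H |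
        ∃ x ∈ E.toSubmodule, ∃ f : C₀(ℕ, ℂ), T = tensorOp x f}) ?_ ?_ ?_ ?_ hS
    · rintro S ⟨x, hx, f, rfl⟩
      exact Submodule.subset_span ⟨star x, E.star_mem' x hx, star f, star_tensorOp x f⟩
    · simp
    · intro S S' _ _ h h'
      rw [star_add]
      exact Submodule.add_mem _ h h'
    · intro c S _ h
      rw [star_smul]
      exact Submodule.smul_mem _ _ h

end Tensor

end

end OpSys

/-! For the CPAP, the first `m` slots of `E ⊗ c₀(ℕ)` form a direct sum of `m` copies of `E`. A
factorization of `θ` through `M_n` then yields, block by block, a cpcc factorization through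
`M_{mn}` of the map applying `θ` in the first `m` slots and `0` elsewhere
(`exists_factorization_truncation`). On `x ⊗ f` this map gives `θ x` tensored with a truncation of
`f`, so it converges on the algebraic tensor product; contractivity extends this to the closure.

For the second claim, let `θ` be an isomorphism of `E ⊗ c₀(ℕ)` onto a C*-algebra `A`, let `P = 1 ⊗
δ₀` and `p = θ P`. Only order and norm are transported by `θ`, yet they force `p` to be a
projection. Indeed `a = 2p - p²` satisfies `0 ≤ a ≤ 1` and `a ≤ 2p`, so `T = θ⁻¹ a` satisfies `0 ≤ T
≤ 1` and `T ≤ 2P`. Since `P` is a projection, `T = PTP ≤ P`; hence `a ≤ p`, that is `p ≤ p²`, while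
`p² ≤ p` always. The corners of `P` and `p` are spanned by positive elements dominated by multiples
of these projections, so `θ` matches them. Thus `E ≅ E ⊗ δ₀ ≅ pAp`, a C*-algebra. -/

namespace OpSys

open ContinuousLinearMap

noncomputable section

/-! ### Diagonal amplifications and block operators -/

section Amplification

variable {H : Type*} [NormedAddCommGroup H] [InnerProductSpace ℂ H]
variable {K : Type*} [NormedAddCommGroup K] [InnerProductSpace ℂ K]

/-- The diagonal amplification `Hⁿ → Kⁿ` of a bounded operator `H → K`. -/
def ampMap (n : ℕ) (W : H →L[ℂ] K) :
    PiLp 2 (fun _ : Fin n => H) →L[ℂ] PiLp 2 (fun _ : Fin n => K) :=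
  ((PiLp.continuousLinearEquiv 2 ℂ (fun _ : Fin n => K)).symm :
      (Fin n → K) →L[ℂ] PiLp 2 (fun _ : Fin n => K)) ∘L
    ContinuousLinearMap.pi fun i => W ∘L PiLp.proj 2 (fun _ : Fin n => H) i

@[simp]
theorem ampMap_apply {n : ℕ} (W : H →L[ℂ] K) (ξ : PiLp 2 (fun _ : Fin n => H)) (i : Fin n) :
    ampMap n W ξ i = W (ξ i) := by
  simp [ampMap]

/-- This turns complete positivity and complete contractivity of `x ↦ U x W` into statements about a
single conjugation. -/
theorem blockOp_conj {n : ℕ} (X : Matrix (Fin n) (Fin n) (H →L[ℂ] H)) (U : H →L[ℂ] K)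
    (W : K →L[ℂ] H) :
    blockOp (X.map fun x => U ∘L x ∘L W) = ampMap n U ∘L blockOp X ∘L ampMap n W := by
  ext ξ i
  simp [blockOp_apply]

theorem blockOp_sum {n : ℕ} {ι : Type*} (s : Finset ι)
    (X : ι → Matrix (Fin n) (Fin n) (H →L[ℂ] H)) :
    blockOp (Matrix.of fun i j => ∑ k ∈ s, X k i j) = ∑ k ∈ s, blockOp (X k) := by
  ext ξ i
  simp only [blockOp_apply, Matrix.of_apply, sum_apply, WithLp.ofLp_sum,
    Finset.sum_apply]
  exact Finset.sum_comm

theorem norm_ampMap_le {n : ℕ} (W : H →L[ℂ] K) (hW : ‖W‖ ≤ 1) : ‖ampMap n W‖ ≤ 1 := by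
  refine opNorm_le_bound _ zero_le_one fun ξ => ?_
  rw [one_mul, PiLp.norm_eq_of_L2, PiLp.norm_eq_of_L2]
  gcongr with i
  rw [ampMap_apply]
  exact (W.le_of_opNorm_le hW _).trans (one_mul _).le

theorem ampMap_comp {n : ℕ} {G : Type*} [NormedAddCommGroup G] [InnerProductSpace ℂ G]
    (V : K →L[ℂ] G) (W : H →L[ℂ] K) : ampMap n V ∘L ampMap n W = ampMap n (V ∘L W) := by
  ext ξ i
  simp

variable [CompleteSpace H] [CompleteSpace K]

theorem adjoint_ampMap {n : ℕ} (W : H →L[ℂ] K) :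
    adjoint (ampMap n W) = ampMap n (adjoint W) := by
  rw [eq_comm, eq_adjoint_iff]
  intro ξ η
  simp [PiLp.inner_apply, adjoint_inner_left]

end Amplification

/-! ### Isometries with orthogonal ranges -/

section OrthogonalSum

variable {H : Type*} [NormedAddCommGroup H] [InnerProductSpace ℂ H] [CompleteSpace H]
variable {K : Type*} [NormedAddCommGroup K] [InnerProductSpace ℂ K] [CompleteSpace K]

theorem norm_sq_sum_of_orthogonal {ι : Type*} [Fintype ι] [DecidableEq ι] (U : ι → H →L[ℂ] K)
    (hU : ∀ k l, adjoint (U k) ∘L U l = if k = l then 1 else 0) (ζ : ι → H) :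
    ‖∑ k, U k (ζ k)‖ ^ 2 = ∑ k, ‖ζ k‖ ^ 2 := by
  have h : ∀ k l, inner ℂ (U k (ζ k)) (U l (ζ l)) =
      if k = l then inner ℂ (ζ k) (ζ l) else 0 := by
    intro k l
    rw [← adjoint_inner_right, ← ContinuousLinearMap.comp_apply, hU]
    split_ifs <;> simp
  have h2 : inner ℂ (∑ k, U k (ζ k)) (∑ k, U k (ζ k)) = ∑ k, inner ℂ (ζ k) (ζ k) := by
    rw [sum_inner]
    refine Finset.sum_congr rfl fun k _ => ?_
    rw [inner_sum]
    simp [h]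
  have h3 := congrArg Complex.re h2
  simp only [inner_self_eq_norm_sq_to_K, Complex.re_sum] at h3
  exact_mod_cast h3

/-- Bessel's inequality for isometries with pairwise orthogonal ranges. -/
theorem sum_norm_sq_adjoint_le {ι : Type*} [Fintype ι] [DecidableEq ι] (U : ι → H →L[ℂ] K)
    (hU : ∀ k l, adjoint (U k) ∘L U l = if k = l then 1 else 0) (ξ : K) :
    ∑ k, ‖adjoint (U k) ξ‖ ^ 2 ≤ ‖ξ‖ ^ 2 := by
  set s := ∑ k, ‖adjoint (U k) ξ‖ ^ 2 with hs
  set y := ∑ k, U k (adjoint (U k) ξ) with hy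
  have h1 : ‖y‖ ^ 2 = s := norm_sq_sum_of_orthogonal U hU _
  have h2 : inner ℂ y ξ = ((s : ℝ) : ℂ) := by
    simp only [hy, hs, sum_inner, Complex.ofReal_sum]
    refine Finset.sum_congr rfl fun k _ => ?_
    rw [← adjoint_inner_right, inner_self_eq_norm_sq_to_K]
    simp
  have h3 : s ≤ ‖y‖ * ‖ξ‖ := by
    have := norm_inner_le_norm (𝕜 := ℂ) y ξ
    rw [h2, Complex.norm_real] at this
    exact (le_abs_self s).trans this
  -- By the arithmetic-geometric mean inequality, `2s ≤ 2‖y‖‖ξ‖ ≤ ‖y‖² + ‖ξ‖² = s + ‖ξ‖²`.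
  nlinarith [sq_nonneg (‖y‖ - ‖ξ‖), norm_nonneg y, norm_nonneg ξ]

/-- Pythagoras on the output and Bessel on the input: a block diagonal operator is controlled by a
common bound on its blocks, with no dependence on their number. -/
theorem norm_sum_conj_le {ι : Type*} [Fintype ι] [DecidableEq ι] (U : ι → H →L[ℂ] K)
    (hU : ∀ k l, adjoint (U k) ∘L U l = if k = l then 1 else 0) (A : ι → H →L[ℂ] H) {c : ℝ}
    (hc : 0 ≤ c) (hA : ∀ k, ‖A k‖ ≤ c) : ‖∑ k, U k ∘L A k ∘L adjoint (U k)‖ ≤ c := by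
  refine opNorm_le_bound _ hc fun ξ => ?_
  refine (sq_le_sq₀ (norm_nonneg _) (by positivity)).1 ?_
  simp only [sum_apply, ContinuousLinearMap.comp_apply]
  rw [norm_sq_sum_of_orthogonal U hU, mul_pow]
  calc ∑ k, ‖A k (adjoint (U k) ξ)‖ ^ 2
      ≤ ∑ k, c ^ 2 * ‖adjoint (U k) ξ‖ ^ 2 := by
        refine Finset.sum_le_sum fun k _ => ?_
        rw [← mul_pow]
        gcongr
        exact (A k).le_of_opNorm_le (hA k) _
    _ ≤ c ^ 2 * ‖ξ‖ ^ 2 := by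
        rw [← Finset.mul_sum]
        gcongr
        exact sum_norm_sq_adjoint_le U hU ξ

end OrthogonalSum

/-! ### Building and using cpcc maps -/

section CPCC

variable {H : Type*} [NormedAddCommGroup H] [InnerProductSpace ℂ H] [CompleteSpace H]
variable {K : Type*} [NormedAddCommGroup K] [InnerProductSpace ℂ K] [CompleteSpace K]
variable {G : Type*} [NormedAddCommGroup G] [InnerProductSpace ℂ G] [CompleteSpace G]

theorem IsCPCC.comp {E : OperatorSystem H} {F : OperatorSystem K} {D : OperatorSystem G}
    {ψ : F.toSubmodule →ₗ[ℂ] D.toSubmodule} {φ : E.toSubmodule →ₗ[ℂ] F.toSubmodule}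
    (hψ : IsCPCC ψ) (hφ : IsCPCC φ) : IsCPCC (E := E) (F := D) (ψ ∘ₗ φ) :=
  ⟨fun n X hX => hψ.1 n (X.map φ) (hφ.1 n X hX),
    fun n X => (hψ.2 n (X.map φ)).trans (hφ.2 n X)⟩

/-- Being cpcc does not depend on the target operator system, only on the operators taken as
values. -/
theorem IsCPCC.congr {E : OperatorSystem H} {F F' : OperatorSystem K}
    {φ : E.toSubmodule →ₗ[ℂ] F.toSubmodule} (hφ : IsCPCC φ)
    (φ' : E.toSubmodule →ₗ[ℂ] F'.toSubmodule) (h : ∀ x, (φ' x : K →L[ℂ] K) = φ x) :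
    IsCPCC φ' := by
  have key : ∀ (n : ℕ) (X : Matrix (Fin n) (Fin n) E.toSubmodule),
      F'.amp (X.map φ') = F.amp (X.map φ) := by
    intro n X
    simp only [OperatorSystem.amp, Matrix.map_map]
    congr 1
    ext1 i j
    exact h _
  exact ⟨fun n X hX => by rw [key]; exact hφ.1 n X hX, fun n X => by rw [key]; exact hφ.2 n X⟩

/-- Compressions are cpcc. -/
theorem isCPCC_of_compression {E : OperatorSystem H} {F : OperatorSystem K}
    (φ : E.toSubmodule →ₗ[ℂ] F.toSubmodule) (V : K →L[ℂ] H) (hV : ‖V‖ ≤ 1)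
    (h : ∀ x, (φ x : K →L[ℂ] K) = adjoint V ∘L (x : H →L[ℂ] H) ∘L V) : IsCPCC φ := by
  have key : ∀ (n : ℕ) (X : Matrix (Fin n) (Fin n) E.toSubmodule),
      F.amp (X.map φ) = adjoint (ampMap n V) ∘L E.amp X ∘L ampMap n V := by
    intro n X
    rw [adjoint_ampMap, OperatorSystem.amp, OperatorSystem.amp, ← blockOp_conj]
    simp only [Matrix.map_map]
    congr 1
    ext1 i j
    exact h _
  refine ⟨fun n X hX => ?_, fun n X => ?_⟩
  · rw [key]
    exact hX.adjoint_conj _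
  · rw [key]
    have h1 := norm_ampMap_le (n := n) V hV
    refine (opNorm_comp_le _ _).trans ?_
    rw [LinearIsometryEquiv.norm_map]
    refine (mul_le_of_le_one_left (norm_nonneg _) h1).trans ?_
    exact (opNorm_comp_le _ _).trans (mul_le_of_le_one_right (norm_nonneg _) h1)

/-- Orthogonal direct sums of cpcc maps are cpcc. -/
theorem isCPCC_of_orthogonal_sum {E : OperatorSystem H} {F : OperatorSystem K}
    {D : OperatorSystem G} (φ : E.toSubmodule →ₗ[ℂ] F.toSubmodule) {ι : Type*} [Fintype ι]
    [DecidableEq ι] (χ : ι → E.toSubmodule →ₗ[ℂ] D.toSubmodule) (hχ : ∀ k, IsCPCC (χ k))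
    (U : ι → G →L[ℂ] K) (hU : ∀ k l, adjoint (U k) ∘L U l = if k = l then 1 else 0)
    (h : ∀ x, (φ x : K →L[ℂ] K) = ∑ k, U k ∘L (χ k x : G →L[ℂ] G) ∘L adjoint (U k)) :
    IsCPCC φ := by
  have key : ∀ (n : ℕ) (X : Matrix (Fin n) (Fin n) E.toSubmodule),
      F.amp (X.map φ) =
        ∑ k, ampMap n (U k) ∘L D.amp (X.map (χ k)) ∘L adjoint (ampMap n (U k)) := by
    intro n X
    simp only [adjoint_ampMap, OperatorSystem.amp, ← blockOp_conj, ← blockOp_sum]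
    congr 1
    ext1 i j
    exact h _
  refine ⟨fun n X hX => ?_, fun n X => ?_⟩
  · rw [key]
    exact isPositive_sum _ fun k _ => ((hχ k).1 n X hX).conj_adjoint _
  · rw [key]
    -- The amplified isometries satisfy the same orthogonality relations, so one bound serves all
    -- matrix levels.
    refine norm_sum_conj_le _ (fun k l => ?_) _ (norm_nonneg _) fun k => (hχ k).2 n X
    rw [adjoint_ampMap, ampMap_comp, hU]
    ext ξ i
    split_ifs <;> simp

/-- Together with `norm_blockOp_one`, this extracts ordinary positivity and contractivity of a cpcc
map from matrix level one. -/
theorem isPositive_blockOp_one_iff {T : H →L[ℂ] H} :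
    (blockOp (Matrix.of fun _ _ : Fin 1 => T)).IsPositive ↔ T.IsPositive := by
  constructor
  · intro h
    let J : H →L[ℂ] PiLp 2 (fun _ : Fin 1 => H) :=
      ((PiLp.continuousLinearEquiv 2 ℂ (fun _ : Fin 1 => H)).symm :
        (Fin 1 → H) →L[ℂ] PiLp 2 (fun _ : Fin 1 => H)) ∘L
          ContinuousLinearMap.pi fun _ => ContinuousLinearMap.id ℂ H
    have h1 : T = adjoint J ∘L blockOp (Matrix.of fun _ _ : Fin 1 => T) ∘L J := by
      refine ContinuousLinearMap.ext fun x => ext_inner_left ℂ fun y => ?_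
      simp only [ContinuousLinearMap.comp_apply, adjoint_inner_right]
      simp [J, PiLp.inner_apply, blockOp_apply]
    rw [h1]
    exact h.adjoint_conj _
  · intro h
    rw [isPositive_def']
    have h1 : blockOp (Matrix.of fun _ _ : Fin 1 => T) = ampMap 1 T := by
      ext ξ i
      simp [blockOp_apply, Subsingleton.elim i 0]
    rw [h1]
    refine ⟨?_, fun ξ => ?_⟩
    · rw [isSelfAdjoint_iff', adjoint_ampMap, isSelfAdjoint_iff'.1 h.isSelfAdjoint]
    · simpa [reApplyInnerSelf, PiLp.inner_apply] using h.re_inner_nonneg_left (ξ 0)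

theorem norm_blockOp_one (T : H →L[ℂ] H) : ‖blockOp (Matrix.of fun _ _ : Fin 1 => T)‖ = ‖T‖ := by
  have hn : ∀ ξ : PiLp 2 (fun _ : Fin 1 => H), ‖ξ‖ = ‖ξ 0‖ := fun ξ => by
    simp [PiLp.norm_eq_of_L2]
  apply le_antisymm
  · refine opNorm_le_bound _ (norm_nonneg _) fun ξ => ?_
    rw [hn, hn, blockOp_apply]
    simpa using T.le_opNorm (ξ 0)
  · refine opNorm_le_bound _ (norm_nonneg _) fun x => ?_
    have := (blockOp (Matrix.of fun _ _ : Fin 1 => T)).le_opNorm (WithLp.toLp 2 fun _ => x)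
    rw [hn, hn, blockOp_apply] at this
    simpa using this

theorem IsCPCC.nonneg {E : OperatorSystem H} {F : OperatorSystem K}
    {φ : E.toSubmodule →ₗ[ℂ] F.toSubmodule} (hφ : IsCPCC φ) {x : E.toSubmodule}
    (hx : 0 ≤ (x : H →L[ℂ] H)) : 0 ≤ (φ x : K →L[ℂ] K) := by
  rw [nonneg_iff_isPositive] at hx ⊢
  rw [← isPositive_blockOp_one_iff] at hx ⊢
  exact hφ.1 1 (Matrix.of fun _ _ => x) hx

theorem IsCPCC.mono {E : OperatorSystem H} {F : OperatorSystem K}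
    {φ : E.toSubmodule →ₗ[ℂ] F.toSubmodule} (hφ : IsCPCC φ) {x y : E.toSubmodule}
    (h : (x : H →L[ℂ] H) ≤ y) : (φ x : K →L[ℂ] K) ≤ φ y := by
  have := hφ.nonneg (x := y - x) (by simpa using h)
  simpa using this

theorem IsCPCC.norm_le {E : OperatorSystem H} {F : OperatorSystem K}
    {φ : E.toSubmodule →ₗ[ℂ] F.toSubmodule} (hφ : IsCPCC φ) (x : E.toSubmodule) :
    ‖φ x‖ ≤ ‖x‖ := by
  have := hφ.2 1 (Matrix.of fun _ _ => x)
  exact ((norm_blockOp_one (φ x : K →L[ℂ] K)).symm.le.trans this).trans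
    (norm_blockOp_one (x : H →L[ℂ] H)).le

end CPCC

/-! ### The slots of `E ⊗ c₀(ℕ)` -/

section Slots

variable {H : Type u} [NormedAddCommGroup H] [InnerProductSpace ℂ H]

/-- The isometric embedding `ξ ↦ ξ ⊗ e_k` of `H` into `H ⊗ ℓ²(ℕ)`. -/
def slot (H : Type u) [NormedAddCommGroup H] [InnerProductSpace ℂ H] (k : ℕ) :
    H →L[ℂ] TensorL2 H :=
  lp.singleContinuousLinearMap ℂ (fun _ : ℕ => H) 2 k

theorem slot_apply (k : ℕ) (ξ : H) : slot H k ξ = lp.single 2 k ξ := rfl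

/-- The indicator function of `{k}`, as an element of `c₀(ℕ)`. -/
def deltaC0 (k : ℕ) : C₀(ℕ, ℂ) where
  toFun := Pi.single k 1
  continuous_toFun := continuous_of_discreteTopology
  zero_at_infty' := by
    rw [cocompact_eq_atTop]
    refine tendsto_const_nhds.congr' ?_
    filter_upwards [eventually_gt_atTop k] with n hn
    rw [Pi.single_eq_of_ne hn.ne']

theorem deltaC0_apply (k n : ℕ) : deltaC0 k n = if n = k then 1 else 0 :=
  Pi.single_apply k (1 : ℂ) n

/-- The error of the `m`-th truncation is the tail of `f`, uniformly small because `f` vanishes at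
infinity. -/
theorem tendsto_sum_smul_deltaC0 (f : C₀(ℕ, ℂ)) :
    Tendsto (fun m => ∑ k : Fin m, f k • deltaC0 k) atTop (𝓝 f) := by
  have happ : ∀ m n : ℕ, (∑ k : Fin m, f k • deltaC0 k : C₀(ℕ, ℂ)) n = if n < m then f n else 0 := by
    intro m n
    rw [Fin.sum_univ_eq_sum_range (fun k => f k • deltaC0 k) m]
    induction m with
    | zero => simp
    | succ m ih =>
      rw [Finset.sum_range_succ, ZeroAtInftyContinuousMap.add_apply, ih,
        ZeroAtInftyContinuousMap.smul_apply, deltaC0_apply]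
      rcases lt_trichotomy n m with h | h | h
      · simp [h, h.ne, h.trans (Nat.lt_succ_self m)]
      · simp [h]
      · simp [h.ne', h.not_gt, (Nat.succ_le_of_lt h).not_gt]
  rw [ZeroAtInftyContinuousMap.tendsto_iff_tendstoUniformly, Metric.tendstoUniformly_iff]
  intro ε hε
  have h0 := f.zero_at_infty'
  rw [cocompact_eq_atTop, Metric.tendsto_atTop] at h0
  obtain ⟨N, hN⟩ := h0 ε hε
  filter_upwards [eventually_ge_atTop N] with m hm n
  rw [happ]
  split_ifs with h
  · simpa using hε
  · exact hN n (hm.trans (not_lt.1 h))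

theorem norm_tensorOp_le (x : H →L[ℂ] H) (f : C₀(ℕ, ℂ)) : ‖tensorOp x f‖ ≤ ‖x‖ * ‖f‖ := by
  rw [mul_comm]
  exact LinearMap.mkContinuous_norm_le _ (by positivity) _

/-- Used for joint continuity, so that approximation in `E` and truncation in `c₀(ℕ)` can be carried
out simultaneously. -/
theorem isBoundedBilinearMap_tensorOp :
    IsBoundedBilinearMap ℂ fun p : (H →L[ℂ] H) × C₀(ℕ, ℂ) => tensorOp p.1 p.2 where
  add_left x x' f := by ext ζ n; simp
  smul_left c x f := by ext ζ n; simpa using smul_comm _ _ _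
  add_right x f f' := by ext ζ n; simp [add_smul]
  smul_right c x f := by ext ζ n; simp [mul_smul]
  bound := ⟨1, one_pos, fun x f => by simpa using norm_tensorOp_le x f⟩

theorem norm_slot_le (k : ℕ) : ‖slot H k‖ ≤ 1 :=
  opNorm_le_bound _ zero_le_one fun ξ => by
    rw [one_mul, slot_apply, lp.norm_single (by norm_num)]

variable [CompleteSpace H]

@[simp]
theorem adjoint_slot_apply (k : ℕ) (ζ : TensorL2 H) : adjoint (slot H k) ζ = ζ k := by
  refine ext_inner_left ℂ fun ξ => ?_
  rw [adjoint_inner_right, slot_apply, lp.inner_single_left]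

theorem adjoint_slot_comp_slot (k l : ℕ) :
    adjoint (slot H k) ∘L slot H l = if k = l then 1 else 0 := by
  ext ξ
  by_cases h : k = l
  · subst h; simp [slot_apply]
  · simp [slot_apply, h, lp.single_apply]

theorem slot_conj (k : ℕ) (x : H →L[ℂ] H) :
    slot H k ∘L x ∘L adjoint (slot H k) = tensorOp x (deltaC0 k) := by
  ext ζ n
  by_cases h : n = k
  · subst h; simp [slot_apply, deltaC0_apply]
  · simp [slot_apply, deltaC0_apply, h, lp.single_apply]

theorem slot_compress (k : ℕ) (x : H →L[ℂ] H) (f : C₀(ℕ, ℂ)) :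
    adjoint (slot H k) ∘L tensorOp x f ∘L slot H k = f k • x := by
  ext ξ
  simp [slot_apply]

theorem tensorOp_mem {E : OperatorSystem H} {x : H →L[ℂ] H} (hx : x ∈ E.toSubmodule)
    (f : C₀(ℕ, ℂ)) : tensorOp x f ∈ (tensorC0 E).toSubmodule :=
  Submodule.le_topologicalClosure _ (Submodule.subset_span ⟨x, hx, f, rfl⟩)

/-- The map `x ↦ U x W`, linear in `x`. -/
def conjLinear {G : Type*} {K : Type*} [NormedAddCommGroup G] [InnerProductSpace ℂ G]
    [NormedAddCommGroup K] [InnerProductSpace ℂ K] (U : G →L[ℂ] K) (W : K →L[ℂ] G) :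
    (G →L[ℂ] G) →ₗ[ℂ] (K →L[ℂ] K) where
  toFun x := U ∘L x ∘L W
  map_add' x y := by ext; simp
  map_smul' c x := by ext; simp

/-- Compression to a slot is continuous and sends `x ⊗ f` to `f k • x`; since `E` is closed,
membership passes from the span to its closure. -/
theorem compress_mem {E : OperatorSystem H} (k : ℕ) {T : TensorL2 H →L[ℂ] TensorL2 H}
    (hT : T ∈ (tensorC0 E).toSubmodule) :
    adjoint (slot H k) ∘L T ∘L slot H k ∈ E.toSubmodule := by
  have hcont : Continuous (conjLinear (adjoint (slot H k)) (slot H k)) :=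
    continuous_const.clm_comp (continuous_id.clm_comp continuous_const)
  change conjLinear (adjoint (slot H k)) (slot H k) T ∈ E.toSubmodule
  refine E.isClosed'.closure_subset (map_mem_closure hcont hT fun S hS => ?_)
  refine (Submodule.span_le (p := E.toSubmodule.comap
    (conjLinear (adjoint (slot H k)) (slot H k)))).2 ?_ hS
  rintro _ ⟨x, hx, f, rfl⟩
  change adjoint (slot H k) ∘L tensorOp x f ∘L slot H k ∈ E.toSubmodule
  rw [slot_compress]
  exact E.toSubmodule.smul_mem _ hx

/-- The `k`-th component `E ⊗ c₀(ℕ) → E`. -/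
def component (E : OperatorSystem H) (k : ℕ) :
    (tensorC0 E).toSubmodule →ₗ[ℂ] E.toSubmodule :=
  (conjLinear (adjoint (slot H k)) (slot H k)).restrict fun _ hT => compress_mem k hT

theorem coe_component (E : OperatorSystem H) (k : ℕ) (T : (tensorC0 E).toSubmodule) :
    (component E k T : H →L[ℂ] H) =
      adjoint (slot H k) ∘L (T : TensorL2 H →L[ℂ] TensorL2 H) ∘L slot H k := rfl

theorem isCPCC_component (E : OperatorSystem H) (k : ℕ) : IsCPCC (component E k) :=
  isCPCC_of_compression _ (slot H k) (norm_slot_le k) (coe_component E k)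

/-- The embedding `x ↦ x ⊗ δ_k` of `E` into `E ⊗ c₀(ℕ)`. -/
def slotEmbedding (E : OperatorSystem H) (k : ℕ) :
    E.toSubmodule →ₗ[ℂ] (tensorC0 E).toSubmodule :=
  (conjLinear (slot H k) (adjoint (slot H k))).restrict fun x hx => by
    change slot H k ∘L x ∘L adjoint (slot H k) ∈ _
    rw [slot_conj]
    exact tensorOp_mem hx _

theorem coe_slotEmbedding (E : OperatorSystem H) (k : ℕ) (x : E.toSubmodule) :
    (slotEmbedding E k x : TensorL2 H →L[ℂ] TensorL2 H) =
      slot H k ∘L (x : H →L[ℂ] H) ∘L adjoint (slot H k) := rfl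

theorem isCPCC_slotEmbedding (E : OperatorSystem H) (k : ℕ) : IsCPCC (slotEmbedding E k) := by
  refine isCPCC_of_compression _ (adjoint (slot H k)) ?_ fun x => ?_
  · rw [LinearIsometryEquiv.norm_map]
    exact norm_slot_le k
  · rw [adjoint_adjoint, coe_slotEmbedding]

theorem component_slotEmbedding (E : OperatorSystem H) (k : ℕ) (x : E.toSubmodule) :
    component E k (slotEmbedding E k x) = x := by
  refine Subtype.ext ?_
  rw [coe_component, coe_slotEmbedding, slot_conj, slot_compress, deltaC0_apply]
  simp

end Slots

/-! ### Block embeddings of `ℂⁿ` into `ℂᵐⁿ` -/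

section Matrices

theorem exists_orthogonal_isometries (m n : ℕ) :
    ∃ U : Fin m → EuclideanSpace ℂ (Fin n) →L[ℂ] EuclideanSpace ℂ (Fin (m * n)),
      ∀ k l, adjoint (U k) ∘L U l = if k = l then 1 else 0 := by
  -- `W k` reads off the `k`-th block of coordinates; its adjoint is the inclusion of that block.
  let W : Fin m → EuclideanSpace ℂ (Fin (m * n)) →L[ℂ] EuclideanSpace ℂ (Fin n) := fun k =>
    ((PiLp.continuousLinearEquiv 2 ℂ (fun _ : Fin n => ℂ)).symm :
      (Fin n → ℂ) →L[ℂ] PiLp 2 (fun _ : Fin n => ℂ)) ∘L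
    ContinuousLinearMap.pi fun j =>
      PiLp.proj 2 (fun _ : Fin (m * n) => ℂ) (finProdFinEquiv (k, j))
  have hW : ∀ k ζ j, W k ζ j = ζ (finProdFinEquiv (k, j)) := fun k ζ j => by simp [W]
  refine ⟨fun k => adjoint (W k), fun k l => ?_⟩
  rw [adjoint_adjoint]
  ext ζ j
  have h1 : W k (adjoint (W l) ζ) j = if k = l then ζ j else 0 := by
    have h2 : ∀ (N : ℕ) (ξ : EuclideanSpace ℂ (Fin N)) (i : Fin N),
        ξ i = inner ℂ (EuclideanSpace.single i (1 : ℂ)) ξ := fun N ξ i => by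
      simp [EuclideanSpace.inner_single_left]
    rw [hW, h2, adjoint_inner_right]
    have h3 : W l (EuclideanSpace.single (finProdFinEquiv (k, j)) (1 : ℂ)) =
        if k = l then EuclideanSpace.single j (1 : ℂ) else 0 := by
      ext i
      rw [hW]
      by_cases h : k = l
      · subst h; simp
      · simp [h, Ne.symm h]
    rw [h3]
    split_ifs
    · rw [← h2]
    · simp
  rw [ContinuousLinearMap.comp_apply, h1]
  split_ifs <;> simp

end Matrices

/-! ### The CPAP for `E ⊗ c₀(ℕ)` -/

section Truncation

variable {H : Type u} [NormedAddCommGroup H] [InnerProductSpace ℂ H] [CompleteSpace H]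

/-- A factorization of `θ` through `M_n` by cpcc maps yields one of the map applying `θ` to the
first `m` components through `M_{mn}`. -/
theorem exists_factorization_truncation (E : OperatorSystem H) (m n : ℕ)
    (ψ : E.toSubmodule →ₗ[ℂ] (matrixSystem n).toSubmodule)
    (φ : (matrixSystem n).toSubmodule →ₗ[ℂ] E.toSubmodule) (hψ : IsCPCC ψ) (hφ : IsCPCC φ) :
    ∃ (Ψ : (tensorC0 E).toSubmodule →ₗ[ℂ] (matrixSystem (m * n)).toSubmodule)
      (Φ : (matrixSystem (m * n)).toSubmodule →ₗ[ℂ] (tensorC0 E).toSubmodule),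
      IsCPCC Ψ ∧ IsCPCC Φ ∧
        ∀ T, Φ (Ψ T) = ∑ k : Fin m, slotEmbedding E k (φ (ψ (component E k T))) := by
  obtain ⟨U, hU⟩ := exists_orthogonal_isometries m n
  -- `Ψ` puts `ψ` of the `k`-th component in the `k`-th diagonal block; `c k` recovers that block,
  -- and `Φ` returns its image under `φ` to slot `k`.
  let Ψ : (tensorC0 E).toSubmodule →ₗ[ℂ] (matrixSystem (m * n)).toSubmodule :=
    (∑ k : Fin m, conjLinear (U k) (adjoint (U k)) ∘ₗ (matrixSystem n).toSubmodule.subtype ∘ₗ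
      ψ ∘ₗ component E k).codRestrict _ fun _ => trivial
  let c : Fin m → (matrixSystem (m * n)).toSubmodule →ₗ[ℂ] (matrixSystem n).toSubmodule :=
    fun k => (conjLinear (adjoint (U k)) (U k)).restrict fun _ _ => trivial
  let Φ : (matrixSystem (m * n)).toSubmodule →ₗ[ℂ] (tensorC0 E).toSubmodule :=
    ∑ k : Fin m, slotEmbedding E k ∘ₗ φ ∘ₗ c k
  have hΨ : ∀ T, (Ψ T : _ →L[ℂ] _) =
      ∑ k : Fin m, U k ∘L ((ψ ∘ₗ component E k) T : _ →L[ℂ] _) ∘L adjoint (U k) := fun T => by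
    simp [Ψ, conjLinear]
  have hUn : ∀ k, ‖U k‖ ≤ 1 := fun k => by
    refine opNorm_le_bound _ zero_le_one fun ξ => ?_
    rw [one_mul, ← sq_le_sq₀ (norm_nonneg _) (norm_nonneg _)]
    have := norm_sq_sum_of_orthogonal U hU (Pi.single k ξ)
    rw [Fintype.sum_eq_single k fun l hl => by simp [hl],
      Fintype.sum_eq_single k fun l hl => by simp [hl], Pi.single_eq_same] at this
    exact this.le
  have hc : ∀ k, IsCPCC (c k) := fun k =>
    isCPCC_of_compression (c k) (U k) (hUn k) fun _ => rfl
  refine ⟨Ψ, Φ, ?_, ?_, fun T => ?_⟩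
  · exact isCPCC_of_orthogonal_sum Ψ (fun k : Fin m => ψ ∘ₗ component E k)
      (fun k => hψ.comp (isCPCC_component E k)) U hU hΨ
  · refine isCPCC_of_orthogonal_sum Φ (fun k => φ ∘ₗ c k) (fun k => hφ.comp (hc k))
      (fun k : Fin m => slot H k) (fun k l => ?_) fun Y => ?_
    · simp only [adjoint_slot_comp_slot, Fin.val_inj]
    · simp [Φ, coe_slotEmbedding]
  · have hcΨ : ∀ k, c k (Ψ T) = ψ (component E k T) := fun k => by
      refine Subtype.ext ?_
      change adjoint (U k) ∘L (Ψ T : _ →L[ℂ] _) ∘L U k = _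
      rw [hΨ]
      ext1 ξ
      have h1 : ∀ l (η : EuclideanSpace ℂ (Fin n)),
          adjoint (U k) (U l η) = if k = l then η else 0 := fun l η => by
        rw [← ContinuousLinearMap.comp_apply, hU]
        split_ifs <;> simp
      have h2 : ∀ l (η : EuclideanSpace ℂ (Fin n)),
          adjoint (U l) (U k η) = if l = k then η else 0 := fun l η => by
        rw [← ContinuousLinearMap.comp_apply, hU]
        split_ifs <;> simp
      simp only [ContinuousLinearMap.comp_apply, sum_apply, map_sum, h1, h2]
      simp
    simp [Φ, hcΨ]

/-- On `x ⊗ f` the sum equals `θ i x` tensored with the truncation of `f`, so joint continuity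
applies; linearity covers the span. -/
theorem tendsto_truncation_of_mem_span {E : OperatorSystem H} {ι : Type*} {l : Filter ι}
    (θ : ι → E.toSubmodule →ₗ[ℂ] E.toSubmodule) (hθ : ∀ x, Tendsto (fun i => θ i x) l (𝓝 x))
    {T : TensorL2 H →L[ℂ] TensorL2 H}
    (hT : T ∈ Submodule.span ℂ {T : TensorL2 H →L[ℂ] TensorL2 H |
      ∃ x ∈ E.toSubmodule, ∃ f : C₀(ℕ, ℂ), T = tensorOp x f})
    (hT' : T ∈ (tensorC0 E).toSubmodule) :
    Tendsto (fun p : ι × ℕ =>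
      ∑ k : Fin p.2, slotEmbedding E k (θ p.1 (component E k ⟨T, hT'⟩)))
      (l ×ˢ atTop) (𝓝 ⟨T, hT'⟩) := by
  induction hT using Submodule.span_induction with
  | mem T hT =>
    obtain ⟨x, hx, f, rfl⟩ := hT
    rw [tendsto_subtype_rng]
    have h1 : Tendsto (fun p : ι × ℕ => ((θ p.1 ⟨x, hx⟩ : H →L[ℂ] H),
        ∑ k : Fin p.2, f k • deltaC0 k)) (l ×ˢ atTop) (𝓝 (x, f)) :=
      ((tendsto_subtype_rng.1 (hθ ⟨x, hx⟩)).comp tendsto_fst).prodMk_nhds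
        ((tendsto_sum_smul_deltaC0 f).comp tendsto_snd)
    have hcont := (isBoundedBilinearMap_tensorOp (H := H)).continuous
    refine ((hcont.tendsto (x, f)).comp h1).congr fun p => ?_
    have h2 : ∀ k, component E k ⟨tensorOp x f, hT'⟩ = f k • ⟨x, hx⟩ := fun k =>
      Subtype.ext (by rw [coe_component, slot_compress]; rfl)
    have h3 : ∀ y, tensorOp y (∑ k : Fin p.2, f k • deltaC0 k) =
        ∑ k : Fin p.2, f k • tensorOp y (deltaC0 k) := fun y => by
      let Λ : C₀(ℕ, ℂ) →ₗ[ℂ] TensorL2 H →L[ℂ] TensorL2 H :=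
        { toFun := tensorOp y
          map_add' := isBoundedBilinearMap_tensorOp.add_right y
          map_smul' := fun c f => isBoundedBilinearMap_tensorOp.smul_right c y f }
      exact (map_sum Λ _ _).trans (Finset.sum_congr rfl fun k _ => map_smul Λ _ _)
    simp only [Function.comp_apply, h2, h3, map_smul, Submodule.coe_sum, Submodule.coe_smul,
      coe_slotEmbedding, slot_conj]
  | zero =>
    have : (⟨0, hT'⟩ : (tensorC0 E).toSubmodule) = 0 := rfl
    simp only [this, map_zero, Finset.sum_const_zero]
    exact tendsto_const_nhds
  | add S S' hS hS' h h' =>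
    have := (h (Submodule.le_topologicalClosure _ hS)).add
      (h' (Submodule.le_topologicalClosure _ hS'))
    simp only [← Finset.sum_add_distrib, ← map_add] at this
    exact this
  | smul c S hS h =>
    have := (h (Submodule.le_topologicalClosure _ hS)).const_smul c
    simp only [Finset.smul_sum, ← map_smul] at this
    exact this

theorem hasCPAP_tensorC0 {E : OperatorSystem H} (hE : HasCPAP E) : HasCPAP (tensorC0 E) := by
  obtain ⟨ι, _, _, _, n, ψ, φ, hn, hψ, hφ, hlim⟩ := hE
  choose Ψ Φ hΨ hΦ hΦΨ using fun p : ι × ℕ =>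
    -- Keeping `p.2 + 1` slots makes the matrix size at least one.
    exists_factorization_truncation E (p.2 + 1) (n p.1) (ψ p.1) (φ p.1) (hψ p.1) (hφ p.1)
  have hdir : IsDirectedOrder (ι × ℕ) := ⟨fun p q =>
    let ⟨i, hpi, hqi⟩ := exists_ge_ge p.1 q.1
    ⟨(i, max p.2 q.2), ⟨hpi, le_max_left _ _⟩, ⟨hqi, le_max_right _ _⟩⟩⟩
  refine ⟨ι × ℕ, inferInstance, hdir, inferInstance, fun p => (p.2 + 1) * n p.1, Ψ, Φ,
    fun p => Nat.mul_pos p.2.succ_pos (hn p.1), hΨ, hΦ, fun T => ?_⟩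
  have hdense : ∀ (S : TensorL2 H →L[ℂ] TensorL2 H) (_ : S ∈ Submodule.span ℂ _)
      (hS' : S ∈ (tensorC0 E).toSubmodule),
      Tendsto (fun p => Φ p (Ψ p ⟨S, hS'⟩)) atTop (𝓝 ⟨S, hS'⟩) := fun S hS hS' => by
    simp only [hΦΨ]
    rw [← prod_atTop_atTop_eq]
    exact (tendsto_truncation_of_mem_span (fun i => φ i ∘ₗ ψ i) hlim hS hS').comp
      (tendsto_id.prodMap (tendsto_add_atTop_nat 1))
  rw [Metric.tendsto_nhds]
  intro ε hε
  obtain ⟨S, hS, hST⟩ := Metric.mem_closure_iff.1 T.2 (ε / 3) (by positivity)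
  have hS' : S ∈ (tensorC0 E).toSubmodule := Submodule.le_topologicalClosure _ hS
  have hST' : dist T ⟨S, hS'⟩ < ε / 3 := hST
  filter_upwards [Metric.tendsto_nhds.1 (hdense S hS hS') (ε / 3) (by positivity)] with p hp
  -- All the composites are contractions, so the approximation error of `S` for `T` does not grow
  -- with `p`.
  have h1 : dist (Φ p (Ψ p T)) (Φ p (Ψ p ⟨S, hS'⟩)) ≤ dist T ⟨S, hS'⟩ := by
    rw [dist_eq_norm, dist_eq_norm, ← map_sub, ← map_sub]
    exact ((hΦ p).norm_le _).trans ((hΨ p).norm_le _)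
  have h2 := dist_triangle4 (Φ p (Ψ p T)) (Φ p (Ψ p ⟨S, hS'⟩)) ⟨S, hS'⟩ T
  rw [dist_comm ⟨S, hS'⟩ T] at h2
  linarith

end Truncation

/-! ### Order characterizations of projections and corners -/

section Corners

variable {A : Type*} [CStarAlgebra A] [PartialOrder A] [StarOrderedRing A]

/-- A positive element dominated by a multiple of a projection lies in the corner of that
projection. -/
theorem mul_eq_self_of_nonneg_of_le_smul {p b : A} (hp : IsStarProjection p) (hb : 0 ≤ b) {c : ℝ}
    (h : b ≤ c • p) : p * b = b ∧ b * p = b := by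
  have hq : IsSelfAdjoint (1 - p) := hp.one_sub.isSelfAdjoint
  obtain ⟨s, rfl⟩ := CStarAlgebra.nonneg_iff_eq_star_mul_self.1 hb
  -- Compressing `b ≤ c • p` by `1 - p` kills the right side; with `b = s* s` this forces `s (1 - p)
  -- = 0`.
  have h1 : (1 - p) * (star s * s) * (1 - p) = 0 := by
    refine le_antisymm ?_ (hq.conjugate_nonneg hb)
    refine (hq.conjugate_le_conjugate h).trans_eq ?_
    rw [mul_smul_comm, hp.one_sub_mul_self, smul_zero, zero_mul]
  have h2 : s * (1 - p) = 0 := by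
    rw [← CStarRing.star_mul_self_eq_zero_iff, star_mul, hq.star_eq, ← h1]
    simp only [mul_assoc]
  have h3 : (star s * s) * p = star s * s := by
    have : s * p = s := by
      rw [mul_sub, mul_one, sub_eq_zero] at h2
      exact h2.symm
    rw [mul_assoc, this]
  refine ⟨?_, h3⟩
  have := congrArg star h3
  simpa [hp.isSelfAdjoint.star_eq] using this

/-- A positive contraction `p` is a projection as soon as `2p - p² ≤ p`. -/
theorem isStarProjection_of_two_smul_sub_le {p : A} (h0 : 0 ≤ p) (h1 : p ≤ 1)
    (h : (2 : ℝ) • p - p * p ≤ p) : IsStarProjection p := by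
  refine ⟨le_antisymm ?_ ?_, .of_nonneg h0⟩
  · have h2 : 0 ≤ p * (1 - p) * p + (1 - p) * p * (1 - p) :=
      add_nonneg ((IsSelfAdjoint.of_nonneg h0).conjugate_nonneg (sub_nonneg.2 h1))
        ((IsSelfAdjoint.of_nonneg (sub_nonneg.2 h1)).conjugate_nonneg h0)
    rw [← sub_nonneg]
    convert h2 using 1
    noncomm_ring
  · rw [two_smul] at h
    rw [← sub_nonneg] at h ⊢
    convert h using 1
    abel

/-- Here `2p - p² = 1 - (1 - p)²`, which gives the bound by `1`. It is the test element for `p`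
being a projection: a contraction dominated by a multiple of `p`. -/
theorem two_smul_sub_mul_self_bounds {p : A} (h0 : 0 ≤ p) (h1 : p ≤ 1) :
    0 ≤ (2 : ℝ) • p - p * p ∧ (2 : ℝ) • p - p * p ≤ (2 : ℝ) • p ∧
      (2 : ℝ) • p - p * p ≤ 1 := by
  have hsa : IsSelfAdjoint p := .of_nonneg h0
  have hsa' : IsSelfAdjoint (1 - p) := .of_nonneg (sub_nonneg.2 h1)
  have h2 : 0 ≤ p * p := by simpa [hsa.star_eq] using star_mul_self_nonneg p
  have h3 : 0 ≤ (1 - p) * (1 - p) := by simpa [hsa'.star_eq] using star_mul_self_nonneg (1 - p)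
  have h4 : 0 ≤ p * (1 - p) * p + (1 - p) * p * (1 - p) :=
      add_nonneg (hsa.conjugate_nonneg (sub_nonneg.2 h1)) (hsa'.conjugate_nonneg h0)
  refine ⟨?_, sub_le_self _ h2, ?_⟩
  · have : (2 : ℝ) • p - p * p = (p * (1 - p) * p + (1 - p) * p * (1 - p)) + p := by
      rw [two_smul]; noncomm_ring
    rw [this]
    exact add_nonneg h4 h0
  · rw [← sub_nonneg]
    convert h3 using 1
    rw [two_smul]; noncomm_ring

/-- Compress `-‖y‖ ≤ y ≤ ‖y‖` by `p`. This writes `y` as a difference of positive elements dominated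
by multiples of `p`. -/
theorem neg_norm_smul_le_and_le {p y : A} (hp : IsStarProjection p) (hy : IsSelfAdjoint y)
    (hpy : p * y * p = y) : 0 ≤ y + ‖y‖ • p ∧ y + ‖y‖ • p ≤ (2 * ‖y‖) • p := by
  have h1 := hp.isSelfAdjoint.conjugate_le_conjugate hy.le_algebraMap_norm_self
  have h2 := hp.isSelfAdjoint.conjugate_le_conjugate hy.neg_algebraMap_norm_le_self
  have h3 : p * algebraMap ℝ A ‖y‖ * p = ‖y‖ • p := by
    rw [Algebra.algebraMap_eq_smul_one, mul_smul_comm, mul_one, smul_mul_assoc,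
      hp.isIdempotentElem.eq]
  rw [hpy, h3] at h1
  rw [mul_neg, neg_mul, hpy, h3] at h2
  refine ⟨by simpa using add_le_add_left h2 (‖y‖ • p), ?_⟩
  rw [two_mul, add_smul]
  exact add_le_add_left h1 _

end Corners

/-! ### Operator systems inside a corner -/

section Systems

variable {H : Type*} [NormedAddCommGroup H] [InnerProductSpace ℂ H] [CompleteSpace H]

/-- An operator system contained in the corner of a projection that it contains is spanned by the
positive elements dominated by multiples of the projection. -/
theorem OperatorSystem.induction_of_unit (E : OperatorSystem H) {p : H →L[ℂ] H}
    (hp : IsStarProjection p) (hpE : p ∈ E.toSubmodule)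
    (hcorner : ∀ x ∈ E.toSubmodule, p * x * p = x) (M : Submodule ℂ E.toSubmodule)
    (hM : ∀ x : E.toSubmodule, 0 ≤ (x : H →L[ℂ] H) → (∃ c : ℝ, (x : H →L[ℂ] H) ≤ c • p) → x ∈ M)
    (x : E.toSubmodule) : x ∈ M := by
  have hpos : ∀ c : ℝ, 0 ≤ c → (0 : H →L[ℂ] H) ≤ c • p := fun c hc =>
    smul_nonneg hc hp.nonneg
  have hsmul : ∀ c : ℝ, c • p = (c : ℂ) • p := fun c => (Complex.coe_smul c p).symm
  have hcpE : ∀ c : ℝ, c • p ∈ E.toSubmodule := fun c => by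
    rw [hsmul]
    exact E.toSubmodule.smul_mem _ hpE
  have hsa : ∀ y : E.toSubmodule, IsSelfAdjoint (y : H →L[ℂ] H) → y ∈ M := by
    intro y hy
    obtain ⟨h1, h2⟩ := neg_norm_smul_le_and_le hp hy (hcorner y y.2)
    have h3 : y + ⟨_, hcpE ‖(y : H →L[ℂ] H)‖⟩ ∈ M := hM _ h1 ⟨_, h2⟩
    have h4 : (⟨_, hcpE ‖(y : H →L[ℂ] H)‖⟩ : E.toSubmodule) ∈ M :=
      hM _ (hpos _ (norm_nonneg _)) ⟨_, le_rfl⟩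
    simpa using M.sub_mem h3 h4
  let s : E.toSubmodule := ⟨star (x : H →L[ℂ] H), E.star_mem' x x.2⟩
  have h1 : x + s ∈ M := hsa _ (IsSelfAdjoint.add_star_self _)
  have h2 : Complex.I • (x - s) ∈ M := hsa _ <| by
    change star (Complex.I • ((x : H →L[ℂ] H) - star (x : H →L[ℂ] H))) = Complex.I • (_ - _)
    rw [star_smul, star_sub, star_star, ← neg_sub, smul_neg]
    simp [s]
  -- Cartesian decomposition: `x + x*` and `i(x - x*)` are both self-adjoint.
  have h3 : x = (2⁻¹ : ℂ) • ((x + s) - Complex.I • Complex.I • (x - s)) := by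
    rw [smul_smul, Complex.I_mul_I, neg_one_smul, sub_neg_eq_add, add_add_sub_cancel, ← two_smul ℂ,
      smul_smul]
    norm_num
  rw [h3]
  exact M.smul_mem _ (M.sub_mem h1 (M.smul_mem _ h2))

/-- The corner `{a ∈ A | pa = a = ap}` of an operator system. -/
def OperatorSystem.corner (A : OperatorSystem H) {p : H →L[ℂ] H} (hp : IsSelfAdjoint p) :
    OperatorSystem H where
  carrier := {a | a ∈ A.toSubmodule ∧ p * a = a ∧ a * p = a}
  add_mem' ha hb := ⟨A.toSubmodule.add_mem ha.1 hb.1, by rw [mul_add, ha.2.1, hb.2.1],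
    by rw [add_mul, ha.2.2, hb.2.2]⟩
  zero_mem' := ⟨A.toSubmodule.zero_mem, mul_zero _, zero_mul _⟩
  smul_mem' c a ha := ⟨A.toSubmodule.smul_mem c ha.1, by rw [mul_smul_comm, ha.2.1],
    by rw [smul_mul_assoc, ha.2.2]⟩
  isClosed' := A.isClosed'.inter
    ((isClosed_eq (continuous_const_mul p) continuous_id).inter
      (isClosed_eq (continuous_mul_const p) continuous_id))
  star_mem' a ha := by
    refine ⟨A.star_mem' a ha.1, ?_, ?_⟩
    · have := congrArg star ha.2.2
      rwa [star_mul, hp.star_eq] at this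
    · have := congrArg star ha.2.1
      rwa [star_mul, hp.star_eq] at this

end Systems

/-! ### Descending the C*-algebra structure to `E` -/

section Main

variable {H : Type u} [NormedAddCommGroup H] [InnerProductSpace ℂ H] [CompleteSpace H]

theorem isStarProjection_slot_one (k : ℕ) :
    IsStarProjection (slot H k ∘L (1 : H →L[ℂ] H) ∘L adjoint (slot H k)) := by
  rw [slot_conj]
  refine ⟨?_, ?_⟩
  · ext ζ n
    by_cases h : n = k <;> simp [deltaC0_apply, h]
  · rw [IsSelfAdjoint, star_tensorOp, star_one]
    congr 1
    ext n
    by_cases h : n = k <;> simp [deltaC0_apply, h]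

/-- An operator in `E ⊗ c₀(ℕ)` that lies in the corner of `1 ⊗ δ_k` is its own `k`-th component. -/
theorem slotEmbedding_component {E : OperatorSystem H} (k : ℕ) {T : (tensorC0 E).toSubmodule}
    (h1 : (slot H k ∘L (1 : H →L[ℂ] H) ∘L adjoint (slot H k)) *
      (T : TensorL2 H →L[ℂ] TensorL2 H) = T)
    (h2 : (T : TensorL2 H →L[ℂ] TensorL2 H) *
      (slot H k ∘L (1 : H →L[ℂ] H) ∘L adjoint (slot H k)) = T) :
    slotEmbedding E k (component E k T) = T := by
  refine Subtype.ext ?_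
  rw [coe_slotEmbedding, coe_component]
  conv_rhs => rw [← h1, ← h2]
  rfl

theorem isCStarAlgebra_of_tensorC0 {E : OperatorSystem H} (hE : E.IsUnital)
    (h : IsCStarAlgebra (tensorC0 E)) : IsCStarAlgebra E := by
  obtain ⟨L, _, _, _, A, hmul, θ, hθ, hθ'⟩ := h
  set P : TensorL2 H →L[ℂ] TensorL2 H :=
    slot H 0 ∘L (1 : H →L[ℂ] H) ∘L adjoint (slot H 0)
  have hP : IsStarProjection P := isStarProjection_slot_one 0
  let one : E.toSubmodule := ⟨1, hE⟩
  let P' : (tensorC0 E).toSubmodule := slotEmbedding E 0 one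
  let p' : A.toSubmodule := θ P'
  set p : L →L[ℂ] L := p'.1
  have hθp : θ.symm p' = P' := θ.symm_apply_apply _
  have hp0 : 0 ≤ p := hθ.nonneg (x := P') hP.nonneg
  have hp1 : p ≤ 1 := by
    rw [← CStarAlgebra.norm_le_one_iff_of_nonneg p hp0]
    exact (hθ.norm_le P').trans
      ((CStarAlgebra.norm_le_one_iff_of_nonneg P hP.nonneg).2 hP.le_one)
  have hcs : ∀ {V : Type u} [NormedAddCommGroup V] [InnerProductSpace ℂ V] [CompleteSpace V]
      (D : OperatorSystem V) (c : ℝ) (x : D.toSubmodule),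
      (((c : ℂ) • x : D.toSubmodule) : V →L[ℂ] V) = c • (x : V →L[ℂ] V) :=
    fun D c x => by rw [Submodule.coe_smul, Complex.coe_smul]
  -- elements of `A` dominated by a multiple of `p` come from the corner of `P`
  have hback : ∀ a : A.toSubmodule, 0 ≤ (a : L →L[ℂ] L) →
      (∃ c : ℝ, (a : L →L[ℂ] L) ≤ c • p) →
      0 ≤ (θ.symm a : TensorL2 H →L[ℂ] TensorL2 H) ∧
        P * (θ.symm a : TensorL2 H →L[ℂ] TensorL2 H) = θ.symm a ∧
        (θ.symm a : TensorL2 H →L[ℂ] TensorL2 H) * P = θ.symm a := by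
    rintro a ha ⟨c, hac⟩
    have h0 : 0 ≤ (θ.symm a : TensorL2 H →L[ℂ] TensorL2 H) := hθ'.nonneg ha
    refine ⟨h0, mul_eq_self_of_nonneg_of_le_smul hP h0 (c := c) ?_⟩
    have := hθ'.mono (x := a) (y := (c : ℂ) • p') (by rw [hcs]; exact hac)
    rwa [map_smul, hcs, LinearEquiv.coe_coe, hθp] at this
  have hp : IsStarProjection p := by
    obtain ⟨ha0, ha2, ha1⟩ := two_smul_sub_mul_self_bounds hp0 hp1
    refine isStarProjection_of_two_smul_sub_le hp0 hp1 ?_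
    -- The element `2p - p²` is available because `A` is closed under multiplication.
    let a : A.toSubmodule := ((2 : ℝ) : ℂ) • p' - ⟨p * p, hmul _ p'.2 _ p'.2⟩
    have ha : (a : L →L[ℂ] L) = (2 : ℝ) • p - p * p := by
      rw [← hcs]; rfl
    rw [← ha] at ha0 ha1 ha2 ⊢
    obtain ⟨hT0, hT1, hT2⟩ := hback a ha0 ⟨2, ha2⟩
    have hTle : (θ.symm a : TensorL2 H →L[ℂ] TensorL2 H) ≤ 1 := by
      rw [← CStarAlgebra.norm_le_one_iff_of_nonneg _ hT0]
      exact (hθ'.norm_le a).trans ((CStarAlgebra.norm_le_one_iff_of_nonneg _ ha0).2 ha1)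
    -- Membership in the corner improves `T ≤ 1` to `T = PTP ≤ P`, removing the factor `2` from `T ≤
    -- 2P`.
    have hTP : (θ.symm a : TensorL2 H →L[ℂ] TensorL2 H) ≤ P := by
      have := hP.isSelfAdjoint.conjugate_le_conjugate hTle
      rwa [hT1, hT2, mul_one, hP.isIdempotentElem.eq] at this
    have := hθ.mono (x := θ.symm a) (y := P') hTP
    rwa [LinearEquiv.coe_coe, θ.apply_symm_apply] at this
  let F : OperatorSystem L := A.corner hp.isSelfAdjoint
  have hpF : p ∈ F.toSubmodule := ⟨p'.2, hp.isIdempotentElem.eq, hp.isIdempotentElem.eq⟩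
  -- `θ` carries `E ⊗ δ₀` into the corner of `p`
  have hfwd : ∀ x : E.toSubmodule, (θ (slotEmbedding E 0 x) : L →L[ℂ] L) ∈ F.toSubmodule := by
    -- Since `E` is unital, it suffices to treat `0 ≤ x ≤ c • 1`, where `θ (x ⊗ δ₀) ≤ c • p`.
    refine E.induction_of_unit (p := 1) (.one _) hE (by simp)
      (F.toSubmodule.comap (A.toSubmodule.subtype ∘ₗ θ.toLinearMap ∘ₗ slotEmbedding E 0)) ?_
    rintro x hx ⟨c, hxc⟩
    refine ⟨(θ (slotEmbedding E 0 x)).2, ?_⟩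
    have h0 : 0 ≤ (θ (slotEmbedding E 0 x) : L →L[ℂ] L) :=
      hθ.nonneg ((isCPCC_slotEmbedding E 0).nonneg hx)
    refine mul_eq_self_of_nonneg_of_le_smul hp h0 (c := c) ?_
    have := (hθ.comp (isCPCC_slotEmbedding E 0)).mono (x := x) (y := (c : ℂ) • one)
      (by rw [hcs]; exact hxc)
    rwa [map_smul, hcs] at this
  let incl : F.toSubmodule →ₗ[ℂ] A.toSubmodule := Submodule.inclusion fun _ ha => ha.1
  have hincl : IsCPCC incl := by
    refine isCPCC_of_compression incl 1 norm_id_le fun x => ?_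
    ext ξ
    simp [incl, ← star_eq_adjoint]
  let f : E.toSubmodule →ₗ[ℂ] F.toSubmodule :=
    (A.toSubmodule.subtype ∘ₗ θ.toLinearMap ∘ₗ slotEmbedding E 0).codRestrict _ hfwd
  let g : F.toSubmodule →ₗ[ℂ] E.toSubmodule := component E 0 ∘ₗ θ.symm.toLinearMap ∘ₗ incl
  have hf : IsCPCC f := (hθ.comp (isCPCC_slotEmbedding E 0)).congr f fun _ => rfl
  have hg : IsCPCC g := (isCPCC_component E 0).comp (hθ'.comp hincl)
  have hgf : ∀ x, g (f x) = x := fun x => by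
    have : incl (f x) = θ (slotEmbedding E 0 x) := rfl
    change component E 0 (θ.symm (incl (f x))) = x
    rw [this, θ.symm_apply_apply, component_slotEmbedding]
  have hfg : ∀ a, f (g a) = a := by
    intro a
    have : a ∈ LinearMap.eqLocus (f ∘ₗ g) LinearMap.id := by
      -- For surjectivity onto the corner, a positive `a ≤ c • p` pulls back into the corner of `P`,
      -- where an operator is determined by its component in slot `0`.
      refine F.induction_of_unit hp hpF (fun a ha => by rw [ha.2.1, ha.2.2]) _ ?_ a
      intro a ha hac
      obtain ⟨-, h1, h2⟩ := hback (incl a) ha hac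
      refine Subtype.ext ?_
      change (θ (slotEmbedding E 0 (component E 0 (θ.symm (incl a)))) : L →L[ℂ] L) = a
      rw [slotEmbedding_component 0 h1 h2, θ.apply_symm_apply]
      rfl
    exact this
  refine ⟨L, inferInstance, inferInstance, inferInstance, F, ?_,
    LinearEquiv.ofLinearMap f g (LinearMap.ext hfg) (LinearMap.ext hgf), hf, hg⟩
  rintro x ⟨hx, hx1, -⟩ y ⟨hy, -, hy2⟩
  exact ⟨hmul x hx y hy, by rw [← mul_assoc, hx1], by rw [mul_assoc, hy2]⟩

end Main

end

end OpSys

theorem mainTheorem5 {H : Type u} [NormedAddCommGroup H] [InnerProductSpace ℂ H]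
    [CompleteSpace H] (E : OpSys.OperatorSystem H) (hunital : E.IsUnital)
    (hcpap : OpSys.HasCPAP E) :
    OpSys.HasCPAP (OpSys.tensorC0 E) ∧
      (OpSys.IsCStarAlgebra (OpSys.tensorC0 E) → OpSys.IsCStarAlgebra E) :=
  ⟨OpSys.hasCPAP_tensorC0 hcpap, OpSys.isCStarAlgebra_of_tensorC0 hunital⟩
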